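/- Let $k$ be a field. A Poisson structure on a commutative $k$-algebra is a $k$-bilinear Lie bracket (in particular $\{a,a\}=0$) that is a derivation in each argument. A $k[[\hbar]]$-module is topologically free if it is isomorphic to $V[[\hbar]]$ for some $k$-vector space $V$. A quantization of a Poisson algebra $A$ is an associative unital $k[[\hbar]]$-algebra $A_\hbar$, topologically free as a $k[[\hbar]]$-module, together with an isomorphism of $k$-algebras $A_\hbar/\hbar A_\hbar\cong A$ under which the Poisson bracket of $A$ is $\{a,b\}=\hbar^{-1}[\tilde a,\tilde b] \bmod \hbar$, where $\tilde a,\tilde b\in A_\hbar$ are any lifts of $a,b$. **Proposition.** Let $A$ be a Poisson algebra over $k$ that is an integral domain, let $K$ be its fraction field, and let $A_\hbar$ be a quantization of $A$. There is a unique Poisson structure on $K$ extending that of $A$; equip $K$ with it. Then: 1. There is a quantization $K_\hbar$ of $K$ that contains $A_\hbar$ as a $k[[\hbar]]$-subalgebra, the inclusion $A_\hbar\subset K_\hbar$ reducing modulo $\hbar$ to the inclusion $A\subset K$. 2. It is unique: if $K'_\hbar$ is another such quantization, there is a unique isomorphism of $k[[\hbar]]$-algebras $K_\hbar\to K'_\hbar$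 that is the identity on $A_\hbar$, and it induces the identity of $K$ modulo $\hbar$. 3. $K_\hbar$ is a skew field after inverting $\hbar$: every element of $K_\hbar$ that is nonzero modulo $\hbar$ is invertible in $K_\hbar$, and the $k((\hbar))$-algebra $K_\hbar[\hbar^{-1}]=k((\hbar))\otimes_{k[[\hbar]]}K_\hbar$ is a skew field. -/

import Mathlib

universe u v w x y

/-- A Poisson structure on a commutative `k`-algebra `A`: a `k`-bilinear Lie bracket which is a
derivation in each argument. -/
@[ext]
structure PoissonStructure (k A : Type*) [Field k] [CommRing A] [Algebra k A] where
  bracket : A →ₗ[k] A →ₗ[k] A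
  bracket_self : ∀ a, bracket a a = 0
  jacobi : ∀ a b c,
    bracket a (bracket b c) + bracket b (bracket c a) + bracket c (bracket a b) = 0
  leibniz : ∀ a b c, bracket a (b * c) = bracket a b * c + b * bracket a c

/-- The Poisson structure `Q` on the `A`-algebra `K` extends the Poisson structure `P` on `A`. -/
def PoissonStructure.Extends {k A K : Type*} [Field k] [CommRing A] [Algebra k A]
    [CommRing K] [Algebra k K] [Algebra A K]
    (Q : PoissonStructure k K) (P : PoissonStructure k A) : Prop :=
  ∀ a b : A, Q.bracket (algebraMap A K a) (algebraMap A K b) = algebraMap A K (P.bracket a b)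

/-- A `k[[ħ]]`-module is topologically free if it is isomorphic to `V[[ħ]]` for some `k`-vector
space `V`. A series `∑ vₙ ħⁿ` is the sequence `(vₙ)`, and `k[[ħ]]` acts by the Cauchy product. -/
def IsTopologicallyFree (k : Type u) (M : Type v) [Field k] [AddCommGroup M]
    [Module (PowerSeries k) M] : Prop :=
  ∃ (V : Type v) (_ : AddCommGroup V) (_ : Module k V) (e : M ≃+ (ℕ → V)),
    ∀ (p : PowerSeries k) (m : M) (n : ℕ),
      e (p • m) n = ∑ ij ∈ Finset.HasAntidiagonal.antidiagonal n, PowerSeries.coeff ij.1 p • e m ij.2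

/-- `B`, with reduction map `π : B → A`, is a quantization of the Poisson algebra `(A, P)`:
`B` is an associative `k[[ħ]]`-algebra, topologically free as a module, `π` is a `k`-algebra map
which induces an isomorphism `B / ħB ≅ A`, and under this isomorphism the bracket of `A` is
`(a, b) ↦ ħ⁻¹[a, b] mod ħ`. -/
structure IsQuantization {k A B : Type*} [Field k] [CommRing A] [Algebra k A] [Ring B]
    [Algebra (PowerSeries k) B] (P : PoissonStructure k A) (π : B →+* A) : Prop where
  topologicallyFree : IsTopologicallyFree k B
  map_algebraMap : ∀ p : PowerSeries k,
    π (algebraMap (PowerSeries k) B p) = algebraMap k A (PowerSeries.constantCoeff p)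
  surjective : Function.Surjective π
  map_eq_zero_iff : ∀ b : B, π b = 0 ↔ ∃ c : B, b = (PowerSeries.X : PowerSeries k) • c
  bracket_eq : ∀ a b c : B, a * b - b * a = (PowerSeries.X : PowerSeries k) • c →
    P.bracket (π a) (π b) = π c

/-- `L`, with reduction map `ρ : L → K`, is a quantization of the Poisson algebra `(K, Q)` that
contains `B` as a `k[[ħ]]`-subalgebra through `ι`; the inclusion lifts the map `A → K`, where
`π : B → A` is the reduction map of `B`. -/
structure IsQuantizationContaining {k A K B L : Type*} [Field k] [CommRing A]
    [CommRing K] [Algebra k K] [Algebra A K] [Ring B] [Algebra (PowerSeries k) B]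
    [Ring L] [Algebra (PowerSeries k) L] (Q : PoissonStructure k K) (π : B →+* A)
    (ρ : L →+* K) (ι : B →ₐ[PowerSeries k] L) : Prop where
  isQuantization : IsQuantization Q ρ
  injective : Function.Injective ι
  reduction : ∀ b : B, ρ (ι b) = algebraMap A K (π b)

/-- A ring is a skew field if it is nonzero and every nonzero element has a two-sided inverse. -/
def IsSkewField (R : Type*) [Ring R] : Prop :=
  Nontrivial R ∧ ∀ x : R, x ≠ 0 → ∃ y : R, x * y = 1 ∧ y * x = 1

/-!
The elements of `B` that are nonzero modulo `ħ` need not form an Ore set in `B`, but they do modulo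
every power of `ħ`: `B / ħB` is commutative, so each commutator with `s` gains a factor `ħ`, and
`sⁿ b` is a left multiple of `s` up to `ħⁿ` (`IsReduction.exists_pow_mul_eq`). They are also regular
modulo `ħⁿ`, because `B` has no `ħ`-torsion and `A` is a domain. The quantization of `K` is the
inverse limit of the Ore localizations of the rings `B / ħⁿ⁺¹B` (`IsReduction.completion`). It has
no `ħ`-torsion, every `ħ`-adic series in it has a unique sum, and its reduction modulo `ħ` is `K`
(`IsReduction.completion_isReduction`); a linear section of the reduction then identifies it with
a module of power series (`HbarComplete.isTopologicallyFree`).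

The Poisson bracket of `K` is not built from that of `A`: any such deformation of a commutative
algebra induces one, `ħ⁻¹[a, b] mod ħ` (`IsReduction.exists_poissonStructure`), and it extends that
of `A` because `B` maps to the completed localization. Its uniqueness is the quotient rule.

If `L` is another quantization of `K` containing `B`, its elements that are nonzero modulo `ħ` are
invertible by the geometric series, so the Ore localizations map to the quotients `L / ħⁿ⁺¹L`, and
the completed localization maps to `L` (`IsReduction.exists_algHom_completion`). This map is the
identity modulo `ħ`, hence bijective, and it is the only one over `B`, because up to any power of
`ħ` every element is a left fraction of elements of `B` (`IsReduction.exists_fraction_mod`).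
Finally, every nonzero element of the quantization of `K` is a power of `ħ` times a unit, so
inverting `ħ` yields a skew field (`IsReduction.isSkewField`).
-/

/-! ### Complete and topologically free modules -/

section Modules

variable {k : Type u} [Field k] {M : Type v} [AddCommGroup M] [Module (PowerSeries k) M]

local notation "ħ" => (PowerSeries.X : PowerSeries k)

variable (k M) in
/-- A `k[[ħ]]`-module is `ħ`-complete if it is `ħ`-torsion free, `ħ`-adically separated, and every
series `∑ aₙ ħⁿ` has a sum. Summation is encoded by an operator on sequences satisfying
`∑ aₙ ħⁿ = a₀ + ħ ∑ aₙ₊₁ ħⁿ`, which determines it by separatedness. -/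
structure HbarComplete : Prop where
  eq_zero_of_smul : ∀ m : M, ħ • m = 0 → m = 0
  separated : ∀ m : M, (∀ n : ℕ, ∃ c : M, m = ħ ^ n • c) → m = 0
  exists_sum : ∃ Λ : (ℕ → M) → M, ∀ a, Λ a = a 0 + ħ • Λ (fun i => a (i + 1))

theorem HbarComplete.smul_cancel (h : HbarComplete k M) {m m' : M} (e : ħ • m = ħ • m') :
    m = m' :=
  sub_eq_zero.1 (h.eq_zero_of_smul _ (by rw [smul_sub, e, sub_self]))

theorem HbarComplete.pow_smul_cancel (h : HbarComplete k M) (n : ℕ) {m m' : M}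
    (e : ħ ^ n • m = ħ ^ n • m') : m = m' := by
  induction n with
  | zero => simpa using e
  | succ n ih =>
    apply ih
    rw [pow_succ', mul_smul, mul_smul] at e
    exact h.smul_cancel e

theorem IsTopologicallyFree.hbarComplete (h : IsTopologicallyFree k M) : HbarComplete k M := by
  obtain ⟨V, _, _, e, he⟩ := h
  have h0 (m : M) : e (ħ • m) 0 = 0 := by
    rw [he]; simp
  have hs (m : M) (n : ℕ) : e (ħ • m) (n + 1) = e m n := by
    rw [he, Finset.Nat.sum_antidiagonal_succ,
      Finset.sum_eq_single (0, n)]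
    · simp
    · rintro ⟨i, j⟩ hij hb
      have : i ≠ 0 := by
        rintro rfl
        simp_all
      simp [PowerSeries.coeff_X, this]
    · simp
  refine ⟨fun m hm => ?_, fun m hm => ?_, ?_⟩
  · apply e.injective
    funext n
    rw [← hs, hm]
    simp
  · have hp (n : ℕ) (c : M) (i : ℕ) (hi : i < n) : e (ħ ^ n • c) i = 0 := by
      induction n generalizing i with
      | zero => omega
      | succ n ih =>
        rw [pow_succ', mul_smul]
        cases i with
        | zero => exact h0 _
        | succ i => rw [hs]; exact ih i (by omega)
    apply e.injective
    funext n
    obtain ⟨c, rfl⟩ := hm (n + 1)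
    rw [hp _ _ _ (Nat.lt_succ_self n), map_zero, Pi.zero_apply]
  · refine ⟨fun a => e.symm fun n => ∑ i ∈ Finset.range (n + 1), e (a i) (n - i), fun a => ?_⟩
    apply e.injective
    funext n
    rw [map_add, Pi.add_apply]
    cases n with
    | zero => simp [h0]
    | succ n =>
      rw [hs, AddEquiv.apply_symm_apply, AddEquiv.apply_symm_apply, Finset.sum_range_succ']
      simp [add_comm]

/-- An `ħ`-complete module is `V[[ħ]]` for `V = M / ħM`: a `k`-linear section `σ` of `M → V`
expands every `m` uniquely as `∑ σ(vₙ) ħⁿ`. -/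
theorem HbarComplete.isTopologicallyFree (h : HbarComplete k M) : IsTopologicallyFree k M := by
  let N : Submodule (PowerSeries k) M := LinearMap.range (LinearMap.lsmul (PowerSeries k) M ħ)
  let _ : Module k M := Module.compHom M (PowerSeries.C (R := k))
  let _ : Module k (M ⧸ N) := Module.compHom (M ⧸ N) (PowerSeries.C (R := k))
  have hC (c : k) (m : M) : c • m = PowerSeries.C c • m := rfl
  let q : M →ₗ[k] M ⧸ N :=
    { toFun := N.mkQ
      map_add' := map_add _
      map_smul' := fun c m => map_smul N.mkQ (PowerSeries.C c) m }
  have hq : Function.Surjective q := N.mkQ_surjective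
  have hq0 (m : M) : q (ħ • m) = 0 := (Submodule.Quotient.mk_eq_zero N).2 ⟨m, rfl⟩
  obtain ⟨σ, hσ⟩ := q.exists_rightInverse_of_surjective (LinearMap.range_eq_top.2 hq)
  replace hσ (v) : q (σ v) = v := LinearMap.congr_fun hσ v
  have hT (m : M) : ∃ t : M, ħ • t = m - σ (q m) := by
    have : q (m - σ (q m)) = 0 := by rw [map_sub, hσ, sub_self]
    exact (Submodule.Quotient.mk_eq_zero N).1 this
  choose T₀ hT₀ using hT
  let T : M →ₗ[k] M :=
    { toFun := T₀
      map_add' := fun a b => h.smul_cancel (by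
        rw [smul_add, hT₀, hT₀, hT₀, map_add, map_add]; abel)
      map_smul' := fun c m => h.smul_cancel (by
        rw [hT₀, RingHom.id_apply, hC c (T₀ m), smul_comm, hT₀, ← hC, map_smul, map_smul,
          smul_sub]) }
  have hT (m : M) : ħ • T m = m - σ (q m) := hT₀ m
  have hTX (m : M) : T (ħ • m) = m := h.smul_cancel (by rw [hT, hq0, map_zero, sub_zero])
  let f : M →ₗ[k] (ℕ → M ⧸ N) := LinearMap.pi fun n => q ∘ₗ T ^ n
  have hf0 (m : M) : f m 0 = q m := rfl
  have hfs (m : M) (n : ℕ) : f m (n + 1) = f (T m) n := by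
    simp [f, pow_succ]
  have hinj : Function.Injective f := by
    rw [← LinearMap.ker_eq_bot, LinearMap.ker_eq_bot']
    refine fun m hm => h.separated m fun n => ?_
    induction n generalizing m with
    | zero => exact ⟨m, by simp⟩
    | succ n ih =>
      obtain ⟨c, hc⟩ := ih (T m) (funext fun n => by rw [← hfs, hm]; rfl)
      refine ⟨c, ?_⟩
      have h0 : q m = 0 := by rw [← hf0, hm]; rfl
      rw [pow_succ', mul_smul, ← hc, hT, h0, map_zero, sub_zero]
  have hsurj : Function.Surjective f := by
    obtain ⟨Λ, hΛ⟩ := h.exists_sum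
    refine fun v => ⟨Λ fun i => σ (v i), funext fun n => ?_⟩
    have hqΛ (v : ℕ → M ⧸ N) : q (Λ fun i => σ (v i)) = v 0 := by
      rw [hΛ, map_add, hq0, hσ, add_zero]
    induction n generalizing v with
    | zero => rw [hf0, hqΛ]
    | succ n ih =>
      have hTΛ : T (Λ fun i => σ (v i)) = Λ fun i => σ (v (i + 1)) :=
        h.smul_cancel (by rw [hT, hqΛ, hΛ, add_sub_cancel_left])
      rw [hfs, hTΛ, ih fun i => v (i + 1)]
  refine ⟨M ⧸ N, inferInstance, inferInstance,
    (LinearEquiv.ofBijective f ⟨hinj, hsurj⟩).toAddEquiv, fun p m n => ?_⟩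
  change f (p • m) n =
    ∑ ij ∈ Finset.HasAntidiagonal.antidiagonal n, PowerSeries.coeff ij.1 p • f m ij.2
  induction n generalizing p with
  | zero =>
    conv_lhs => rw [PowerSeries.eq_X_mul_shift_add_const p]
    rw [add_smul, mul_smul, map_add, ← hC, map_smul f, Pi.add_apply, hf0, hq0]
    rw [Finset.Nat.antidiagonal_zero, Finset.sum_singleton, zero_add,
      PowerSeries.coeff_zero_eq_constantCoeff]
    rfl
  | succ n ih =>
    conv_lhs => rw [PowerSeries.eq_X_mul_shift_add_const p]
    rw [add_smul, mul_smul, map_add, ← hC, map_smul f, Pi.add_apply, hfs, hTX, ih,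
      Finset.Nat.sum_antidiagonal_succ, add_comm, PowerSeries.coeff_zero_eq_constantCoeff]
    simp only [PowerSeries.coeff_mk]
    rfl

theorem HbarComplete.eq_of_forall_pow (h : HbarComplete k M) {m m' : M}
    (e : ∀ n : ℕ, ∃ c : M, m - m' = ħ ^ n • c) : m = m' :=
  sub_eq_zero.1 (h.separated _ e)

/-- A sequence whose `n`-th step is divisible by `ħⁿ⁺¹` converges. -/
theorem HbarComplete.exists_lim (h : HbarComplete k M) (y : ℕ → M)
    (hy : ∀ n, ∃ c, y (n + 1) - y n = ħ ^ (n + 1) • c) :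
    ∃ m, ∀ n, ∃ c, m - y n = ħ ^ (n + 1) • c := by
  obtain ⟨Λ, hΛ⟩ := h.exists_sum
  choose c hc using hy
  refine ⟨y 0 + ħ • Λ c, fun n => ⟨Λ fun i => c (i + n), ?_⟩⟩
  induction n with
  | zero => simp
  | succ n ih =>
    rw [sub_eq_iff_eq_add'.1 (hc n), ← sub_sub, ih, hΛ, zero_add, smul_add,
      add_sub_cancel_left, pow_succ _ (n + 1), mul_smul]
    simp only [add_assoc, add_comm 1 n]

theorem HbarComplete.eq_zero_of_forall_eq_smul_succ (h : HbarComplete k M) (d : ℕ → M)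
    (hd : ∀ j, d j = ħ • d (j + 1)) (j : ℕ) : d j = 0 := by
  refine h.separated _ fun n => ⟨d (j + n), ?_⟩
  induction n with
  | zero => simp
  | succ n ih => rw [ih, hd (j + n), pow_succ, mul_smul]; rfl

/-- Every nonzero element is `ħⁿ` times an element outside `ħM`. -/
theorem HbarComplete.exists_eq_pow_smul (h : HbarComplete k M) {m : M} (hm : m ≠ 0) :
    ∃ (n : ℕ) (c : M), m = ħ ^ n • c ∧ ∀ d : M, c ≠ ħ • d := by
  by_contra! H
  refine hm (h.separated m fun n => ?_)
  induction n with
  | zero => exact ⟨m, by simp⟩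
  | succ n ih =>
    obtain ⟨c, hc⟩ := ih
    obtain ⟨d, hd⟩ := H n c hc
    exact ⟨d, by rw [hc, hd, pow_succ, mul_smul]⟩

/-- A linear map between `ħ`-complete modules is bijective as soon as it is so modulo `ħ`. -/
theorem HbarComplete.bijective_of_mod {M' : Type*} [AddCommGroup M'] [Module (PowerSeries k) M']
    (h : HbarComplete k M) (h' : HbarComplete k M') (f : M →ₗ[PowerSeries k] M')
    (hinj : ∀ (m : M) (d : M'), f m = ħ • d → ∃ c : M, m = ħ • c)
    (hsurj : ∀ m' : M', ∃ (m : M) (d : M'), m' = f m + ħ • d) : Function.Bijective f := by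
  constructor
  · rw [← LinearMap.ker_eq_bot, LinearMap.ker_eq_bot']
    intro m hm
    by_contra hm0
    obtain ⟨n, c, rfl, hc⟩ := h.exists_eq_pow_smul hm0
    have hfc : f c = 0 := h'.pow_smul_cancel n (by rw [← map_smul, hm, smul_zero])
    obtain ⟨d, hd⟩ := hinj c 0 (by rw [hfc, smul_zero])
    exact hc d hd
  · intro m'
    choose g t hgt using hsurj
    obtain ⟨Λ, hΛ⟩ := h.exists_sum
    refine ⟨Λ fun i => g (t^[i] m'), h'.eq_of_forall_pow fun n => ?_⟩
    induction n generalizing m' with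
    | zero => exact ⟨_, by rw [pow_zero, one_smul]⟩
    | succ n ih =>
      obtain ⟨c, hc⟩ := ih (t m')
      refine ⟨c, ?_⟩
      rw [pow_succ', mul_smul, ← hc, hΛ, map_add, map_smul, smul_sub]
      conv_lhs => enter [2]; rw [hgt m']
      simp

end Modules

/-! ### Deformations, their Poisson brackets and their units -/

section Reductions

variable {k : Type u} [Field k]

local notation "ħ" => (PowerSeries.X : PowerSeries k)

/-- In an `ħ`-complete algebra, `1 - ħw` is inverted by the geometric series. -/
theorem HbarComplete.isUnit_one_sub {L : Type*} [Ring L] [Algebra (PowerSeries k) L]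
    (h : HbarComplete k L) (w : L) : IsUnit (1 - ħ • w) := by
  obtain ⟨Λ, hΛ⟩ := h.exists_sum
  have hu (j : ℕ) : Λ (fun i => w ^ (i + j)) = w ^ j + ħ • Λ (fun i => w ^ (i + (j + 1))) := by
    rw [hΛ, zero_add]
    simp only [add_assoc, add_comm 1 j]
  have h1 := h.eq_zero_of_forall_eq_smul_succ
    (fun j => (1 - ħ • w) * Λ (fun i => w ^ (i + j)) - w ^ j) (fun j => by
      rw [hu, pow_succ' w j]
      simp only [mul_add, sub_mul, one_mul, smul_mul_assoc, mul_smul_comm, smul_sub]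
      abel) 0
  have h2 := h.eq_zero_of_forall_eq_smul_succ
    (fun j => Λ (fun i => w ^ (i + j)) * (1 - ħ • w) - w ^ j) (fun j => by
      rw [hu, pow_succ w j]
      simp only [add_mul, mul_sub, mul_one, smul_mul_assoc, mul_smul_comm, smul_sub, smul_add]
      abel) 0
  rw [sub_eq_zero, pow_zero] at h1 h2
  exact ⟨⟨_, _, h1, h2⟩, rfl⟩

variable {A : Type v} [CommRing A] [Algebra k A] {B : Type w} [Ring B] [Algebra (PowerSeries k) B]

/-- `B` is an `ħ`-complete deformation of the commutative algebra `A`, with reduction map `π`: a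
quantization without a prescribed bracket. -/
structure IsReduction (π : B →+* A) : Prop where
  complete : HbarComplete k B
  map_algebraMap : ∀ p : PowerSeries k,
    π (algebraMap (PowerSeries k) B p) = algebraMap k A (PowerSeries.constantCoeff p)
  surjective : Function.Surjective π
  map_eq_zero_iff : ∀ b : B, π b = 0 ↔ ∃ c : B, b = ħ • c

theorem IsQuantization.isReduction {P : PoissonStructure k A} {π : B →+* A}
    (h : IsQuantization P π) : IsReduction (k := k) π :=
  ⟨h.topologicallyFree.hbarComplete, h.map_algebraMap, h.surjective, h.map_eq_zero_iff⟩

namespace IsReduction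

variable {π : B →+* A} (h : IsReduction (k := k) π)
include h

theorem map_X_smul (b : B) : π (ħ • b) = 0 := (h.map_eq_zero_iff _).2 ⟨b, rfl⟩

theorem map_C_smul (c : k) (b : B) : π (PowerSeries.C c • b) = c • π b := by
  rw [Algebra.smul_def, map_mul, h.map_algebraMap, PowerSeries.constantCoeff_C, Algebra.smul_def]

/-- The commutator of a deformation of a commutative algebra, divided by `ħ` and reduced
modulo `ħ`, is a Poisson bracket. -/
theorem exists_poissonStructure : ∃ Q : PoissonStructure k A,
    ∀ a b c : B, a * b - b * a = ħ • c → Q.bracket (π a) (π b) = π c := by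
  have hc (a b : B) : ∃ c, a * b - b * a = ħ • c :=
    (h.map_eq_zero_iff _).1 (by rw [map_sub, map_mul, map_mul, mul_comm, sub_self])
  choose κ hκ using hc
  have hX (a b : B) : π (κ (ħ • a) b) = 0 := by
    have : κ (ħ • a) b = ħ • κ a b := h.complete.smul_cancel (by
      rw [← hκ, ← hκ, smul_mul_assoc, mul_smul_comm, smul_sub])
    rw [this, h.map_X_smul]
  have hneg (a b : B) : κ b a = -κ a b := h.complete.smul_cancel (by
    rw [smul_neg, ← hκ, ← hκ, neg_sub])
  have hadd (a a' b : B) : κ (a + a') b = κ a b + κ a' b := h.complete.smul_cancel (by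
    rw [smul_add, ← hκ, ← hκ, ← hκ]; noncomm_ring)
  have hsmul (p : PowerSeries k) (a b : B) : κ (p • a) b = p • κ a b :=
    h.complete.smul_cancel (by
      rw [smul_comm, ← hκ, ← hκ, smul_mul_assoc, mul_smul_comm, smul_sub])
  have hwell (a a' b : B) (e : π a = π a') : π (κ a b) = π (κ a' b) := by
    obtain ⟨c, hc⟩ := (h.map_eq_zero_iff (a - a')).1 (by rw [map_sub, e, sub_self])
    rw [sub_eq_iff_eq_add.1 hc, hadd, map_add, hX, zero_add]
  have hwell' (a b b' : B) (e : π b = π b') : π (κ a b) = π (κ a b') := by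
    rw [hneg b a, hneg b' a, map_neg, map_neg, hwell b b' a e]
  obtain ⟨σ, hσ⟩ := h.surjective.hasRightInverse
  let β (x y : A) : A := π (κ (σ x) (σ y))
  have hβ (a b : B) : β (π a) (π b) = π (κ a b) :=
    (hwell _ _ _ (hσ _)).trans (hwell' _ _ _ (hσ _))
  have hβneg (x y : A) : β y x = -β x y := by
    simp only [β]; rw [hneg, map_neg]
  have hβadd (x x' y : A) : β (x + x') y = β x y + β x' y := by
    obtain ⟨a, rfl⟩ := h.surjective x
    obtain ⟨a', rfl⟩ := h.surjective x'
    obtain ⟨b, rfl⟩ := h.surjective y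
    rw [← map_add, hβ, hβ, hβ, hadd, map_add]
  have hβsmul (c : k) (x y : A) : β (c • x) y = c • β x y := by
    obtain ⟨a, rfl⟩ := h.surjective x
    obtain ⟨b, rfl⟩ := h.surjective y
    rw [← h.map_C_smul, hβ, hβ, hsmul, h.map_C_smul]
  refine ⟨⟨LinearMap.mk₂ k β hβadd hβsmul ?_ ?_, fun x => ?_, fun x y z => ?_, fun x y z => ?_⟩,
    fun a b c e => ?_⟩
  · intro x y y'
    rw [hβneg _ x, hβneg y, hβneg y', hβadd, neg_add]
  · intro c x y
    rw [hβneg _ x, hβneg y, hβsmul, smul_neg]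
  · obtain ⟨a, rfl⟩ := h.surjective x
    rw [LinearMap.mk₂_apply, hβ]
    have : κ a a = 0 := h.complete.smul_cancel (by rw [← hκ, sub_self, smul_zero])
    rw [this, map_zero]
  · obtain ⟨a, rfl⟩ := h.surjective x
    obtain ⟨b, rfl⟩ := h.surjective y
    obtain ⟨c, rfl⟩ := h.surjective z
    simp only [LinearMap.mk₂_apply, hβ]
    have hhc (a b c : B) :
        ħ • ħ • κ a (κ b c) = a * (b * c - c * b) - (b * c - c * b) * a := by
      rw [← hκ, hκ b c, mul_smul_comm, smul_mul_assoc, smul_sub]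
    have : κ a (κ b c) + κ b (κ c a) + κ c (κ a b) = 0 :=
      h.complete.smul_cancel (h.complete.smul_cancel (by
        simp only [smul_add, hhc, smul_zero]; noncomm_ring))
    rw [← map_add, ← map_add, this, map_zero]
  · obtain ⟨a, rfl⟩ := h.surjective x
    obtain ⟨b, rfl⟩ := h.surjective y
    obtain ⟨c, rfl⟩ := h.surjective z
    simp only [LinearMap.mk₂_apply]
    rw [← map_mul, hβ, hβ, hβ, ← map_mul, ← map_mul, ← map_add]
    congr 1
    apply h.complete.smul_cancel
    rw [smul_add, ← hκ, ← smul_mul_assoc, ← mul_smul_comm, ← hκ, ← hκ]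
    noncomm_ring
  · rw [LinearMap.mk₂_apply, hβ]
    exact congrArg π (h.complete.smul_cancel (by rw [← hκ, e]))

end IsReduction

/-- In a deformation of a field every element that is nonzero modulo `ħ` is invertible. -/
theorem IsReduction.isUnit {K : Type*} [Field K] [Algebra k K] {ρ : B →+* K}
    (h : IsReduction (k := k) ρ) {z : B} (hz : ρ z ≠ 0) : IsUnit z := by
  obtain ⟨t, ht⟩ := h.surjective (ρ z)⁻¹
  obtain ⟨a, ha⟩ := (h.map_eq_zero_iff (1 - z * t)).1 (by
    rw [map_sub, map_mul, ht, map_one, mul_inv_cancel₀ hz, sub_self])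
  obtain ⟨b, hb⟩ := (h.map_eq_zero_iff (1 - t * z)).1 (by
    rw [map_sub, map_mul, ht, map_one, inv_mul_cancel₀ hz, sub_self])
  have hzt : IsUnit (z * t) := by
    rw [← sub_sub_cancel 1 (z * t), ha]; exact h.complete.isUnit_one_sub a
  have htz : IsUnit (t * z) := by
    rw [← sub_sub_cancel 1 (t * z), hb]; exact h.complete.isUnit_one_sub b
  obtain ⟨r, hr⟩ := hzt.exists_right_inv
  obtain ⟨l, hl⟩ := htz.exists_left_inv
  rw [mul_assoc] at hr
  rw [← mul_assoc] at hl
  exact ⟨⟨z, t * r, hr, by rwa [← left_inv_eq_right_inv hl hr]⟩, rfl⟩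

theorem IsReduction.exists_eq_pow_smul_isUnit {K : Type*} [Field K] [Algebra k K] {ρ : B →+* K}
    (h : IsReduction (k := k) ρ) {z : B} (hz : z ≠ 0) :
    ∃ (n : ℕ) (c : B), z = ħ ^ n • c ∧ IsUnit c := by
  obtain ⟨n, c, hc, hd⟩ := h.complete.exists_eq_pow_smul hz
  refine ⟨n, c, hc, h.isUnit fun h0 => ?_⟩
  obtain ⟨d, hcd⟩ := (h.map_eq_zero_iff c).1 h0
  exact hd d hcd

/-- Inverting `ħ` in a deformation of a field gives a skew field: every element of
`k((ħ)) ⊗ L` is, up to a power of `ħ`, an element of `L`, which is a power of `ħ` times a unit. -/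
theorem IsReduction.isSkewField {K : Type*} [Field K] [Algebra k K] {ρ : B →+* K}
    (h : IsReduction (k := k) ρ) :
    IsSkewField (TensorProduct (PowerSeries k) (LaurentSeries k) B) := by
  let j : B →ₐ[PowerSeries k] TensorProduct (PowerSeries k) (LaurentSeries k) B :=
    Algebra.TensorProduct.includeRight
  have hloc : IsLocalizedModule (Submonoid.powers ħ) j.toLinearMap :=
    (isLocalizedModule_iff_isBaseChange (Submonoid.powers ħ) (LaurentSeries k) _).2
      (TensorProduct.isBaseChange (PowerSeries k) B (LaurentSeries k))
  have hinj (z : B) (hz : j z = 0) : z = 0 := by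
    obtain ⟨⟨_, n, rfl⟩, hn⟩ := (IsLocalizedModule.eq_zero_iff (Submonoid.powers ħ)
      j.toLinearMap (m := z)).1 hz
    exact h.complete.pow_smul_cancel n (by rw [smul_zero]; exact hn)
  have hX (n : ℕ) : ∃ u : TensorProduct (PowerSeries k) (LaurentSeries k) B,
      u * j (algebraMap _ B (ħ ^ n)) = 1 ∧ ∀ x, Commute u x := by
    have hu : IsUnit (algebraMap (PowerSeries k) (LaurentSeries k) (ħ ^ n)) :=
      IsLocalization.map_units (M := Submonoid.powers ħ) _ ⟨ħ ^ n, n, rfl⟩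
    obtain ⟨t, ht⟩ := hu.exists_left_inv
    refine ⟨algebraMap (LaurentSeries k) _ t, ?_, Algebra.commutes t⟩
    rw [AlgHom.commutes, IsScalarTower.algebraMap_apply (PowerSeries k) (LaurentSeries k),
      ← map_mul, ht, map_one]
  have : Nontrivial B := ρ.domain_nontrivial
  refine ⟨⟨1, 0, fun h10 => one_ne_zero (hinj 1 (by rw [map_one, h10]))⟩, fun x hx => ?_⟩
  obtain ⟨⟨z, ⟨_, n, rfl⟩⟩, hzx⟩ := IsLocalizedModule.surj (Submonoid.powers ħ) j.toLinearMap x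
  replace hzx : j (algebraMap _ B (ħ ^ n)) * x = j z := by
    rw [AlgHom.commutes, ← Algebra.smul_def]; exact hzx
  obtain ⟨u, hu, huc⟩ := hX n
  have hxz : x = u * j z := by rw [← hzx, ← mul_assoc, hu, one_mul]
  have hz : z ≠ 0 := by
    rintro rfl
    exact hx (by rw [hxz, map_zero, mul_zero])
  obtain ⟨m, c, rfl, ⟨c, rfl⟩⟩ := h.exists_eq_pow_smul_isUnit hz
  obtain ⟨v, hv, hvc⟩ := hX m
  rw [Algebra.smul_def, map_mul] at hxz
  have hunit : IsUnit x := by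
    rw [hxz]
    refine IsUnit.mul ⟨⟨u, _, hu, ?_⟩, rfl⟩ (IsUnit.mul ⟨⟨_, v, ?_, hv⟩, rfl⟩ (c.isUnit.map j))
    · rw [← huc]; exact hu
    · rw [← hvc]; exact hv
  exact ⟨_, hunit.mul_val_inv, hunit.val_inv_mul⟩

end Reductions

/-! ### Poisson structures on the fraction field -/

/-- Two Poisson structures on the fraction field which agree on `A` are equal, both being
derivations in each argument. -/
theorem PoissonStructure.Extends.unique {k A K : Type*} [Field k] [CommRing A] [IsDomain A]
    [Algebra k A] [Field K] [Algebra k K] [Algebra A K] [IsFractionRing A K]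
    {P : PoissonStructure k A} {Q Q' : PoissonStructure k K} (h : Q.Extends P)
    (h' : Q'.Extends P) : Q' = Q := by
  have hsymm (Q : PoissonStructure k K) (x y : K) : Q.bracket x y = -Q.bracket y x := by
    have := Q.bracket_self (x + y)
    simp only [map_add, LinearMap.add_apply, Q.bracket_self, zero_add, add_zero] at this
    exact eq_neg_of_add_eq_zero_right this
  have key (x : K) (hx : ∀ a : A, Q'.bracket x (algebraMap A K a) = Q.bracket x (algebraMap A K a))
      (y : K) : Q'.bracket x y = Q.bracket x y := by
    obtain ⟨a, s, hs, rfl⟩ := IsFractionRing.div_surjective (A := A) y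
    have hs0 : algebraMap A K s ≠ 0 := IsFractionRing.to_map_ne_zero_of_mem_nonZeroDivisors hs
    have e := Q.leibniz x (algebraMap A K s) (algebraMap A K a / algebraMap A K s)
    have e' := Q'.leibniz x (algebraMap A K s) (algebraMap A K a / algebraMap A K s)
    rw [mul_div_cancel₀ _ hs0] at e e'
    rw [hx, hx, e] at e'
    exact (mul_left_cancel₀ hs0 (add_left_cancel e')).symm
  ext x y
  refine key x (fun a => ?_) y
  rw [hsymm Q', hsymm Q, key _ fun b => (h' a b).trans (h a b).symm]

/-! ### Ore localization modulo powers of `ħ` -/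

section Localization

variable {k : Type u} [Field k] {A : Type v} [CommRing A] [Algebra k A]
  {B : Type w} [Ring B] [Algebra (PowerSeries k) B]

local notation "ħ" => (PowerSeries.X : PowerSeries k)

variable (k B) in
/-- The two-sided ideal `ħⁿ⁺¹B`. The exponent is shifted so that reduction modulo `ħ` factors
through every quotient `B / ħⁿ⁺¹B`. -/
def hbarIdeal (n : ℕ) : Ideal B where
  carrier := {b | ∃ c : B, b = ħ ^ (n + 1) • c}
  add_mem' := by
    rintro _ _ ⟨c, rfl⟩ ⟨d, rfl⟩
    exact ⟨c + d, (smul_add _ _ _).symm⟩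
  zero_mem' := ⟨0, (smul_zero _).symm⟩
  smul_mem' := by
    rintro a _ ⟨c, rfl⟩
    exact ⟨a * c, mul_smul_comm _ _ _⟩

theorem mem_hbarIdeal {n : ℕ} {b : B} : b ∈ hbarIdeal k B n ↔ ∃ c : B, b = ħ ^ (n + 1) • c :=
  Iff.rfl

instance (n : ℕ) : (hbarIdeal k B n).IsTwoSided where
  mul_mem_of_left := by
    rintro _ b ⟨c, rfl⟩
    exact ⟨c * b, smul_mul_assoc _ _ _⟩

variable (k) in
/-- The image in `B / ħⁿ⁺¹B` of the elements of `B` that are nonzero modulo `ħ`. -/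
def levelDenoms (π : B →+* A) (n : ℕ) : Submonoid (B ⧸ hbarIdeal k B n) :=
  ((nonZeroDivisors A).comap π).map (Ideal.Quotient.mk (hbarIdeal k B n))

namespace IsReduction

variable [IsDomain A] {π : B →+* A}

section
variable (h : IsReduction (k := k) π)
include h

theorem eq_pow_smul_of_mul_left {s : B} (hs : π s ≠ 0) (n : ℕ) {b c : B}
    (e : s * b = ħ ^ n • c) : ∃ d, b = ħ ^ n • d := by
  induction n generalizing b with
  | zero => exact ⟨b, by simp⟩
  | succ n ih =>
    rw [pow_succ', mul_smul] at e
    have hb : π b = 0 := (mul_eq_zero.1 (by rw [← map_mul, e, h.map_X_smul])).resolve_left hs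
    obtain ⟨b', rfl⟩ := (h.map_eq_zero_iff b).1 hb
    rw [mul_smul_comm] at e
    obtain ⟨d, rfl⟩ := ih (h.complete.smul_cancel e)
    exact ⟨d, by rw [pow_succ', mul_smul]⟩

theorem eq_pow_smul_of_mul_right {s : B} (hs : π s ≠ 0) (n : ℕ) {b c : B}
    (e : b * s = ħ ^ n • c) : ∃ d, b = ħ ^ n • d := by
  induction n generalizing b with
  | zero => exact ⟨b, by simp⟩
  | succ n ih =>
    rw [pow_succ', mul_smul] at e
    have hb : π b = 0 := (mul_eq_zero.1 (by rw [← map_mul, e, h.map_X_smul])).resolve_right hs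
    obtain ⟨b', rfl⟩ := (h.map_eq_zero_iff b).1 hb
    rw [smul_mul_assoc] at e
    obtain ⟨d, rfl⟩ := ih (h.complete.smul_cancel e)
    exact ⟨d, by rw [pow_succ', mul_smul]⟩

omit [IsDomain A] in
/-- The left Ore condition modulo `ħⁿ`: each commutator with `s` gains a factor `ħ`, so that
`sⁿ b` is a left multiple of `s` up to `ħⁿ`. -/
theorem exists_pow_mul_eq (s b : B) (n : ℕ) : ∃ b' c : B, s ^ n * b = b' * s + ħ ^ n • c := by
  induction n with
  | zero => exact ⟨0, b, by simp⟩
  | succ n ih =>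
    obtain ⟨b', c, e⟩ := ih
    obtain ⟨d, hd⟩ := (h.map_eq_zero_iff (s * c - c * s)).1 (by
      rw [map_sub, map_mul, map_mul, mul_comm, sub_self])
    refine ⟨s * b' + ħ ^ n • c, d, ?_⟩
    rw [pow_succ', mul_assoc, e, mul_add, mul_smul_comm, sub_eq_iff_eq_add.1 hd, smul_add,
      pow_succ, mul_smul, add_mul, smul_mul_assoc, mul_assoc]
    abel

theorem mk_mul_mk_eq_zero {n : ℕ} {s : B} (hs : s ∈ (nonZeroDivisors A).comap π)
    {r : B ⧸ hbarIdeal k B n} (e : Ideal.Quotient.mk _ s * r = 0) : r = 0 := by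
  obtain ⟨b, rfl⟩ := Ideal.Quotient.mk_surjective r
  rw [← map_mul, Ideal.Quotient.eq_zero_iff_mem] at e
  obtain ⟨c, hc⟩ := e
  exact Ideal.Quotient.eq_zero_iff_mem.2
    (h.eq_pow_smul_of_mul_left (nonZeroDivisors.ne_zero hs) _ hc)

theorem nonempty_oreSet (n : ℕ) : Nonempty (OreLocalization.OreSet (levelDenoms k π n)) := by
  rw [OreLocalization.nonempty_oreSet_iff]
  constructor
  · rintro r₁ r₂ ⟨_, s, hs, rfl⟩ e
    obtain ⟨b₁, rfl⟩ := Ideal.Quotient.mk_surjective r₁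
    obtain ⟨b₂, rfl⟩ := Ideal.Quotient.mk_surjective r₂
    rw [← map_mul, ← map_mul, Ideal.Quotient.mk_eq_mk_iff_sub_mem, ← sub_mul] at e
    obtain ⟨c, hc⟩ := e
    refine ⟨1, congrArg _ (Ideal.Quotient.mk_eq_mk_iff_sub_mem _ _ |>.2 ?_)⟩
    exact h.eq_pow_smul_of_mul_right (nonZeroDivisors.ne_zero hs) _ hc
  · rintro r ⟨_, s, hs, rfl⟩
    obtain ⟨b, rfl⟩ := Ideal.Quotient.mk_surjective r
    obtain ⟨b', c, e⟩ := h.exists_pow_mul_eq s b (n + 1)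
    refine ⟨Ideal.Quotient.mk _ b', ⟨_, s ^ (n + 1), pow_mem hs _, rfl⟩, ?_⟩
    change Ideal.Quotient.mk _ (s ^ (n + 1)) * _ = _ * Ideal.Quotient.mk _ s
    rw [← map_mul, ← map_mul, Ideal.Quotient.mk_eq_mk_iff_sub_mem]
    exact ⟨c, by rw [e, add_sub_cancel_left]⟩

/-- A choice of Ore numerators and denominators for the denominators of level `n`. -/
noncomputable abbrev oreSet (n : ℕ) : OreLocalization.OreSet (levelDenoms k π n) :=
  (h.nonempty_oreSet n).some

/-- The Ore localization of `B / ħⁿ⁺¹B` at the elements that are nonzero modulo `ħ`. -/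
abbrev Level (n : ℕ) : Type w :=
  letI := h.oreSet n
  OreLocalization (levelDenoms k π n) (B ⧸ hbarIdeal k B n)

end

variable (h : IsReduction (k := k) π) (n : ℕ)

/-- The map `B → B / ħⁿ⁺¹B → Level n`. -/
noncomputable def toLevel : B →ₐ[PowerSeries k] h.Level n :=
  letI := h.oreSet n
  { (OreLocalization.numeratorRingHom (S := levelDenoms k π n)).comp
      (Ideal.Quotient.mk (hbarIdeal k B n)) with
    commutes' := fun _ => rfl }

theorem isUnit_toLevel {s : B} (hs : π s ≠ 0) : IsUnit (h.toLevel n s) :=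
  letI := h.oreSet n
  OreLocalization.numerator_isUnit (S := levelDenoms k π n)
    ⟨Ideal.Quotient.mk _ s, s, mem_nonZeroDivisors_of_ne_zero hs, rfl⟩

theorem exists_toLevel_mul_eq (x : h.Level n) :
    ∃ s b : B, π s ≠ 0 ∧ h.toLevel n s * x = h.toLevel n b := by
  let _ := h.oreSet n
  change OreLocalization (levelDenoms k π n) (B ⧸ hbarIdeal k B n) at x
  induction x using OreLocalization.ind with
  | _ r s =>
    obtain ⟨b, rfl⟩ := Ideal.Quotient.mk_surjective r
    obtain ⟨_, s, hs, rfl⟩ := s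
    refine ⟨s, b, nonZeroDivisors.ne_zero hs, ?_⟩
    exact OreLocalization.mul_cancel (S := levelDenoms k π n)
      (s := ⟨_, s, hs, rfl⟩) (t := 1) (r := Ideal.Quotient.mk _ b)

theorem toLevel_eq_zero_iff {b : B} : h.toLevel n b = 0 ↔ ∃ c, b = ħ ^ (n + 1) • c := by
  let _ := h.oreSet n
  have hS : levelDenoms k π n ≤ nonZeroDivisorsLeft _ := by
    rintro _ ⟨s, hs, rfl⟩ r e
    exact h.mk_mul_mk_eq_zero hs e
  have hinj := OreLocalization.numeratorHom_inj hS
  rw [← mem_hbarIdeal, ← Ideal.Quotient.eq_zero_iff_mem]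
  refine Iff.trans ?_ (_root_.map_eq_zero_iff (OreLocalization.numeratorRingHom) hinj)
  rfl

/-- The universal property of `Level n`. -/
noncomputable def levelLift {C : Type*} [Ring C] (g : B →+* C) (hg : ∀ s, π s ≠ 0 → IsUnit (g s))
    (hg0 : ∀ c : B, g (ħ ^ (n + 1) • c) = 0) : h.Level n →+* C :=
  have hg0' : ∀ b ∈ hbarIdeal k B n, g b = 0 := by
    rintro _ ⟨c, rfl⟩
    exact hg0 c
  let g' : B ⧸ hbarIdeal k B n →+* C := Ideal.Quotient.lift _ g hg0'
  have hg' : ∀ s : levelDenoms k π n,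
      IsUnit ((g'.toMonoidHom.comp (levelDenoms k π n).subtype) s) := by
    rintro ⟨_, s, hs, rfl⟩
    exact hg s (nonZeroDivisors.ne_zero hs)
  letI := h.oreSet n
  OreLocalization.universalHom g' (IsUnit.liftRight _ hg') (fun _ => rfl)

theorem levelLift_toLevel {C : Type*} [Ring C] (g : B →+* C)
    (hg : ∀ s, π s ≠ 0 → IsUnit (g s)) (hg0 : ∀ c : B, g (ħ ^ (n + 1) • c) = 0) (b : B) :
    h.levelLift n g hg hg0 (h.toLevel n b) = g b :=
  letI := h.oreSet n
  OreLocalization.universalHom_commutes _ _ _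

variable {n}

/-- Ring homomorphisms out of `Level n` are determined on `B`. -/
theorem level_hom_ext {C : Type*} [Ring C] {φ ψ : h.Level n →+* C}
    (e : ∀ b, φ (h.toLevel n b) = ψ (h.toLevel n b)) : φ = ψ := by
  ext x
  obtain ⟨s, b, hs, hx⟩ := h.exists_toLevel_mul_eq n x
  apply ((h.isUnit_toLevel n hs).map φ).mul_left_cancel
  conv_rhs => rw [e]
  rw [← map_mul, ← map_mul, hx, e]

end IsReduction

end Localization

/-! ### The completed localization -/

theorem IsFractionRing.algebraMap_ne_zero {A : Type*} [CommRing A] (K : Type*) [Field K]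
    [Algebra A K] [IsFractionRing A K] {a : A} (ha : a ≠ 0) : algebraMap A K a ≠ 0 :=
  (map_ne_zero_iff _ (IsFractionRing.injective A K)).2 ha

section Completion

variable {k : Type u} [Field k] {A : Type v} [CommRing A] [IsDomain A] [Algebra k A]
  {B : Type w} [Ring B] [Algebra (PowerSeries k) B]

local notation "ħ" => (PowerSeries.X : PowerSeries k)

namespace IsReduction

variable {π : B →+* A} (h : IsReduction (k := k) π) (n : ℕ)

theorem pow_smul_level (x : h.Level n) : ħ ^ (n + 1) • x = 0 := by
  rw [Algebra.smul_def, ← AlgHom.commutes (h.toLevel n), Algebra.algebraMap_eq_smul_one,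
    (h.toLevel_eq_zero_iff n).2 ⟨1, rfl⟩, zero_mul]

/-- The transition map `Level (n + 1) → Level n` as a ring homomorphism. -/
noncomputable def transitionRingHom : h.Level (n + 1) →+* h.Level n :=
  h.levelLift (n + 1) (h.toLevel n).toRingHom (fun _ hs => h.isUnit_toLevel n hs)
    (fun c => (h.toLevel_eq_zero_iff n).2 ⟨ħ • c, by rw [pow_succ, mul_smul]⟩)

theorem transitionRingHom_toLevel (b : B) :
    h.transitionRingHom n (h.toLevel (n + 1) b) = h.toLevel n b :=
  h.levelLift_toLevel _ _ _ _ _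

/-- The transition map `Level (n + 1) → Level n`. -/
noncomputable def transition : h.Level (n + 1) →ₐ[PowerSeries k] h.Level n :=
  { h.transitionRingHom n with
    commutes' := fun p => by
      rw [← AlgHom.commutes (h.toLevel (n + 1)), ← AlgHom.commutes (h.toLevel n)]
      exact h.transitionRingHom_toLevel n _ }

theorem transition_toLevel (b : B) : h.transition n (h.toLevel (n + 1) b) = h.toLevel n b :=
  h.transitionRingHom_toLevel n b

/-- The annihilator of `ħ` in `Level (n + 1)` is contained in the kernel of the transition map,
which expresses that `Level (n + 1)` is flat over `k[ħ]/(ħⁿ⁺²)`. -/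
theorem transition_eq_zero {x : h.Level (n + 1)} (hx : ħ • x = 0) : h.transition n x = 0 := by
  obtain ⟨s, b, hs, e⟩ := h.exists_toLevel_mul_eq _ x
  have hb : h.toLevel (n + 1) (ħ • b) = 0 := by
    rw [map_smul, ← e, ← mul_smul_comm, hx, mul_zero]
  obtain ⟨c, hc⟩ := (h.toLevel_eq_zero_iff _).1 hb
  rw [pow_succ', mul_smul] at hc
  apply (h.isUnit_toLevel n hs).mul_left_cancel
  rw [← h.transition_toLevel n s, ← map_mul, e, transition_toLevel, mul_zero,
    toLevel_eq_zero_iff]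
  exact ⟨c, h.complete.smul_cancel hc⟩

section FractionField

variable (K : Type x) [Field K] [Algebra A K] [IsFractionRing A K]

/-- Reduction modulo `ħ` of `Level n`, with values in the fraction field `K` of `A`. -/
noncomputable def levelReduction : h.Level n →+* K :=
  h.levelLift n ((algebraMap A K).comp π)
    (fun _ hs => (IsFractionRing.algebraMap_ne_zero K hs).isUnit)
    (fun c => by rw [pow_succ', mul_smul, RingHom.comp_apply, h.map_X_smul, map_zero])

theorem levelReduction_toLevel (b : B) :
    h.levelReduction n K (h.toLevel n b) = algebraMap A K (π b) :=
  h.levelLift_toLevel _ _ _ _ _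

theorem levelReduction_transition (x : h.Level (n + 1)) :
    h.levelReduction n K (h.transition n x) = h.levelReduction (n + 1) K x := by
  have : (h.levelReduction n K).comp (h.transition n).toRingHom = h.levelReduction (n + 1) K :=
    h.level_hom_ext fun b => by
      rw [levelReduction_toLevel, ← h.levelReduction_toLevel n K, ← h.transition_toLevel n]
      rfl
  exact RingHom.congr_fun this x

theorem exists_eq_smul_of_levelReduction {x : h.Level n} (hx : h.levelReduction n K x = 0) :
    ∃ u, x = ħ • u := by
  obtain ⟨s, b, hs, e⟩ := h.exists_toLevel_mul_eq _ x
  have hb : π b = 0 := by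
    apply IsFractionRing.injective A K
    rw [← h.levelReduction_toLevel n K, ← e, map_mul, hx, mul_zero, map_zero]
  obtain ⟨c, rfl⟩ := (h.map_eq_zero_iff b).1 hb
  obtain ⟨s', hs'⟩ := h.isUnit_toLevel n hs
  refine ⟨(s'⁻¹ : (h.Level n)ˣ) * h.toLevel n c, ?_⟩
  rw [← mul_smul_comm, Units.eq_inv_mul_iff_mul_eq, hs', e, map_smul]

end FractionField

/-- The completed localization of `B` at the elements that are nonzero modulo `ħ`: the inverse
limit of the algebras `Level n`. -/
noncomputable def completion : Subalgebra (PowerSeries k) (∀ n, h.Level n) where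
  carrier := {z | ∀ n, h.transition n (z (n + 1)) = z n}
  mul_mem' ha hb n := by rw [Pi.mul_apply, map_mul, ha n, hb n, Pi.mul_apply]
  add_mem' ha hb n := by rw [Pi.add_apply, map_add, ha n, hb n, Pi.add_apply]
  algebraMap_mem' p n := AlgHom.commutes (h.transition n) p

/-- The inclusion of `B` into its completed localization. -/
noncomputable def toCompletion : B →ₐ[PowerSeries k] h.completion where
  toFun b := ⟨fun n => h.toLevel n b, fun n => h.transition_toLevel n b⟩
  map_one' := Subtype.ext (funext fun n => map_one (h.toLevel n))
  map_mul' a b := Subtype.ext (funext fun n => map_mul (h.toLevel n) a b)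
  map_zero' := Subtype.ext (funext fun n => map_zero (h.toLevel n))
  map_add' a b := Subtype.ext (funext fun n => map_add (h.toLevel n) a b)
  commutes' p := Subtype.ext (funext fun n => AlgHom.commutes (h.toLevel n) p)

theorem toCompletion_injective : Function.Injective h.toCompletion := by
  refine (injective_iff_map_eq_zero _).2 fun b hb => h.complete.separated b fun n => ?_
  obtain ⟨c, rfl⟩ := (h.toLevel_eq_zero_iff n).1 (congrFun (congrArg Subtype.val hb) n)
  exact ⟨ħ • c, by rw [pow_succ, mul_smul]⟩

theorem completion_hbarComplete : HbarComplete k h.completion where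
  eq_zero_of_smul z hz := by
    refine Subtype.ext (funext fun n => ?_)
    rw [← z.2 n]
    exact h.transition_eq_zero n (congrFun (congrArg Subtype.val hz) (n + 1))
  separated z hz := by
    refine Subtype.ext (funext fun n => ?_)
    obtain ⟨c, rfl⟩ := hz (n + 1)
    exact h.pow_smul_level n _
  exists_sum := by
    -- At level `n` the series stops at `ħⁿ`, since `ħⁿ⁺¹` acts there as zero.
    refine ⟨fun a => ⟨fun n => ∑ i ∈ Finset.range (n + 1), ħ ^ i • (a i).1 n, fun n => ?_⟩,
      fun a => Subtype.ext (funext fun n => ?_)⟩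
    · rw [map_sum, Finset.sum_range_succ]
      simp only [map_smul]
      rw [(a (n + 1)).2 n, h.pow_smul_level, add_zero]
      exact Finset.sum_congr rfl fun i _ => by rw [(a i).2 n]
    · change ∑ i ∈ Finset.range (n + 1), ħ ^ i • (a i).1 n =
        (a 0).1 n + ħ • ∑ i ∈ Finset.range (n + 1), ħ ^ i • (a (i + 1)).1 n
      rw [Finset.sum_range_succ', Finset.sum_range_succ _ n, smul_add, ← mul_smul, ← pow_succ',
        h.pow_smul_level, add_zero, Finset.smul_sum, pow_zero, one_smul, add_comm]
      simp only [← mul_smul, ← pow_succ']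

section FractionField

variable (K : Type x) [Field K] [Algebra A K] [IsFractionRing A K]

/-- The reduction modulo `ħ` of the completed localization. -/
noncomputable def completionReduction : h.completion →+* K :=
  (h.levelReduction 0 K).comp
    ((Pi.evalRingHom (fun n => h.Level n) 0).comp h.completion.val.toRingHom)

theorem completionReduction_toCompletion (b : B) :
    h.completionReduction K (h.toCompletion b) = algebraMap A K (π b) :=
  h.levelReduction_toLevel 0 K b

theorem levelReduction_eval (z : h.completion) :
    h.levelReduction n K (z.1 n) = h.completionReduction K z := by
  induction n with
  | zero => rfl
  | succ n ih => rw [← ih, ← z.2 n, levelReduction_transition]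

theorem completion_isReduction [Algebra k K] [IsScalarTower k A K] :
    IsReduction (k := k) (h.completionReduction K) where
  complete := h.completion_hbarComplete
  map_algebraMap p := by
    rw [← AlgHom.commutes h.toCompletion, completionReduction_toCompletion, h.map_algebraMap,
      ← IsScalarTower.algebraMap_apply]
  surjective x := by
    obtain ⟨a, s, hs, rfl⟩ := IsFractionRing.div_surjective (A := A) x
    obtain ⟨b, rfl⟩ := h.surjective a
    obtain ⟨s, rfl⟩ := h.surjective s
    have hs0 : π s ≠ 0 := nonZeroDivisors.ne_zero hs
    choose u hu using fun n => h.isUnit_toLevel n hs0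
    -- The fraction `s⁻¹ b`, formed at every level.
    let z : h.completion := ⟨fun n => (u n)⁻¹.1 * h.toLevel n b, fun n => by
      rw [map_mul, Units.eq_inv_mul_iff_mul_eq, hu, ← transition_toLevel, ← mul_assoc, ← map_mul,
        ← hu, Units.mul_inv, map_one, one_mul, transition_toLevel]⟩
    have hz : h.toCompletion s * z = h.toCompletion b := Subtype.ext (funext fun n => by
      change h.toLevel n s * ((u n)⁻¹.1 * h.toLevel n b) = h.toLevel n b
      rw [← mul_assoc, ← hu, Units.mul_inv, one_mul])
    refine ⟨z, ?_⟩
    rw [eq_div_iff (IsFractionRing.algebraMap_ne_zero K hs0), mul_comm,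
      ← h.completionReduction_toCompletion, ← map_mul, hz, completionReduction_toCompletion]
  map_eq_zero_iff z := by
    constructor
    · intro hz
      choose u hu using fun n => h.exists_eq_smul_of_levelReduction n K
        ((h.levelReduction_eval n K z).trans hz)
      -- The quotient of `z` by `ħ` at level `n` is only well defined one level down.
      refine ⟨⟨fun n => h.transition n (u (n + 1)), fun n => ?_⟩, Subtype.ext (funext fun n => ?_)⟩
      · rw [← sub_eq_zero, ← map_sub]
        apply h.transition_eq_zero
        rw [smul_sub, ← map_smul, ← hu, ← hu, z.2, sub_self]
      · change z.1 n = ħ • h.transition n (u (n + 1))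
        rw [← map_smul, ← hu, z.2]
    · rintro ⟨c, rfl⟩
      rw [← h.levelReduction_eval 0 K]
      change h.levelReduction 0 K (ħ • c.1 0) = 0
      have := h.pow_smul_level 0 (c.1 0)
      rw [zero_add, pow_one] at this
      rw [this, map_zero]

end FractionField

end IsReduction

end Completion

/-! ### Deformations of the fraction field containing `B` -/

section Uniqueness

variable {k : Type u} [Field k] {A : Type v} [CommRing A] [IsDomain A] [Algebra k A]
  {B : Type w} [Ring B] [Algebra (PowerSeries k) B] {π : B →+* A}
  {K : Type x} [Field K] [Algebra k K] [Algebra A K] [IsFractionRing A K]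

local notation "ħ" => (PowerSeries.X : PowerSeries k)

namespace IsReduction

section
variable {L : Type*} [Ring L] [Algebra (PowerSeries k) L] {ρ : L →+* K}
  {ι : B →ₐ[PowerSeries k] L}

omit [IsDomain A] [Algebra k A] in
theorem isUnit_of_extends (hρ : IsReduction (k := k) ρ)
    (hι : ∀ b, ρ (ι b) = algebraMap A K (π b)) {s : B} (hs : π s ≠ 0) : IsUnit (ι s) :=
  hρ.isUnit (by rw [hι]; exact IsFractionRing.algebraMap_ne_zero K hs)

/-- In a deformation of `K` containing `B`, every element is a left fraction of elements of `B`
up to any given power of `ħ`. -/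
theorem exists_fraction_mod (h : IsReduction (k := k) π) (hρ : IsReduction (k := k) ρ)
    (hι : ∀ b, ρ (ι b) = algebraMap A K (π b)) (z : L) (n : ℕ) :
    ∃ (s b : B) (w : L), π s ≠ 0 ∧ ι s * z = ι b + ħ ^ n • w := by
  have : Nontrivial B := π.domain_nontrivial
  induction n with
  | zero => exact ⟨1, 0, z, by simp, by simp⟩
  | succ n ih =>
    obtain ⟨s, b, w, hs, e⟩ := ih
    obtain ⟨a, t, ht, hat⟩ := IsFractionRing.div_surjective (A := A) (ρ w)
    obtain ⟨c, rfl⟩ := h.surjective a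
    obtain ⟨t, rfl⟩ := h.surjective t
    have ht0 : π t ≠ 0 := nonZeroDivisors.ne_zero ht
    obtain ⟨w', hw'⟩ := (hρ.map_eq_zero_iff (ι t * w - ι c)).1 (by
      rw [map_sub, map_mul, hι, hι, ← hat,
        mul_div_cancel₀ _ (IsFractionRing.algebraMap_ne_zero K ht0), sub_self])
    refine ⟨t * s, t * b + ħ ^ n • c, w', by rw [map_mul]; exact mul_ne_zero ht0 hs, ?_⟩
    rw [map_mul, mul_assoc, e, mul_add, mul_smul_comm, sub_eq_iff_eq_add.1 hw', map_add, map_mul,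
      map_smul, smul_add, pow_succ, mul_smul]
    abel

variable {L' : Type*} [Ring L'] [Algebra (PowerSeries k) L'] {ρ' : L' →+* K}
  {ι' : B →ₐ[PowerSeries k] L'}

theorem algHom_ext_of_extends (h : IsReduction (k := k) π) (hρ : IsReduction (k := k) ρ)
    (hι : ∀ b, ρ (ι b) = algebraMap A K (π b)) (hρ' : IsReduction (k := k) ρ')
    (hι' : ∀ b, ρ' (ι' b) = algebraMap A K (π b)) {e e' : L →ₐ[PowerSeries k] L'}
    (he : ∀ b, e (ι b) = ι' b) (he' : ∀ b, e' (ι b) = ι' b) (z : L) : e z = e' z := by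
  refine hρ'.complete.eq_of_forall_pow fun n => ?_
  obtain ⟨s, b, w, hs, e0⟩ := h.exists_fraction_mod hρ hι z n
  obtain ⟨u, hu⟩ := hρ'.isUnit_of_extends hι' hs
  refine ⟨u⁻¹.1 * (e w - e' w), ?_⟩
  have e1 := congrArg e e0
  have e2 := congrArg e' e0
  rw [map_mul, map_add, map_smul, he, he] at e1
  rw [map_mul, map_add, map_smul, he', he'] at e2
  rw [← mul_smul_comm, Units.eq_inv_mul_iff_mul_eq, hu, mul_sub, e1, e2, smul_sub,
    add_sub_add_left_eq_sub]

theorem map_eq_of_extends (h : IsReduction (k := k) π) (hρ : IsReduction (k := k) ρ)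
    (hι : ∀ b, ρ (ι b) = algebraMap A K (π b)) (hρ' : IsReduction (k := k) ρ')
    (hι' : ∀ b, ρ' (ι' b) = algebraMap A K (π b)) {e : L →ₐ[PowerSeries k] L'}
    (he : ∀ b, e (ι b) = ι' b) (z : L) : ρ' (e z) = ρ z := by
  obtain ⟨s, b, w, hs, e0⟩ := h.exists_fraction_mod hρ hι z 1
  rw [pow_one] at e0
  have e1 := congrArg (ρ' ∘ e) e0
  have e2 := congrArg ρ e0
  simp only [Function.comp_apply, map_mul, map_add, map_smul, he, hι', hρ'.map_X_smul] at e1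
  simp only [map_mul, map_add, hι, hρ.map_X_smul] at e2
  exact mul_left_cancel₀ (IsFractionRing.algebraMap_ne_zero K hs) (e1.trans e2.symm)

theorem bijective_of_extends (hρ : IsReduction (k := k) ρ) (hρ' : IsReduction (k := k) ρ')
    (e : L →ₐ[PowerSeries k] L') (he : ∀ z, ρ' (e z) = ρ z) : Function.Bijective e := by
  refine hρ.complete.bijective_of_mod hρ'.complete e.toLinearMap (fun m d hm => ?_) fun m' => ?_
  · rw [← hρ.map_eq_zero_iff, ← he, ← AlgHom.toLinearMap_apply, hm, hρ'.map_X_smul]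
  · obtain ⟨m, hm⟩ := hρ.surjective (ρ' m')
    obtain ⟨d, hd⟩ := (hρ'.map_eq_zero_iff (m' - e m)).1 (by rw [map_sub, he, hm, sub_self])
    exact ⟨m, d, (sub_eq_iff_eq_add'.1 hd)⟩

end

variable {L : Type*} [Ring L] [Algebra (PowerSeries k) L] {ρ : L →+* K}
  {ι : B →ₐ[PowerSeries k] L}

/-- The completed localization maps to every deformation of `K` containing `B`: its levels map to
the quotients by powers of `ħ`, and the maps pass to the limit. -/
theorem exists_algHom_completion (h : IsReduction (k := k) π) (hρ : IsReduction (k := k) ρ)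
    (hι : ∀ b, ρ (ι b) = algebraMap A K (π b)) :
    ∃ e : h.completion →ₐ[PowerSeries k] L, ∀ b, e (h.toCompletion b) = ι b := by
  let q (n : ℕ) : L →+* L ⧸ hbarIdeal k L n := Ideal.Quotient.mk _
  have hq (n : ℕ) (a b : L) : q n a = q n b ↔ ∃ c, a - b = ħ ^ (n + 1) • c :=
    Ideal.Quotient.mk_eq_mk_iff_sub_mem a b
  have hqext (a b : L) (e : ∀ n, q n a = q n b) : a = b :=
    hρ.complete.eq_of_forall_pow fun n => by
      obtain ⟨c, hc⟩ := (hq n a b).1 (e n)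
      exact ⟨ħ • c, by rw [hc, pow_succ, mul_smul]⟩
  have hunit (n : ℕ) (s : B) (hs : π s ≠ 0) : IsUnit ((q n).comp ι.toRingHom s) :=
    (hρ.isUnit_of_extends hι hs).map (q n)
  have hker (n : ℕ) (c : B) : (q n).comp ι.toRingHom (ħ ^ (n + 1) • c) = 0 :=
    Ideal.Quotient.eq_zero_iff_mem.2 ⟨ι c, map_smul ι _ _⟩
  let ψ (n : ℕ) : h.Level n →+* L ⧸ hbarIdeal k L n :=
    h.levelLift n ((q n).comp ι.toRingHom) (hunit n) (hker n)
  have hψ (n : ℕ) (b : B) : ψ n (h.toLevel n b) = q n (ι b) := h.levelLift_toLevel _ _ _ _ _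
  have hle (n : ℕ) : ∀ a ∈ hbarIdeal k L (n + 1), q n a = 0 := by
    rintro _ ⟨c, rfl⟩
    exact Ideal.Quotient.eq_zero_iff_mem.2 ⟨ħ • c, by rw [pow_succ, mul_smul]⟩
  let r (n : ℕ) : L ⧸ hbarIdeal k L (n + 1) →+* L ⧸ hbarIdeal k L n :=
    Ideal.Quotient.lift _ (q n) (hle n)
  have hr (n : ℕ) (a : L) : r n (q (n + 1) a) = q n a := Ideal.Quotient.lift_mk _ _ _
  have hcompat (n : ℕ) : (r n).comp (ψ (n + 1)) = (ψ n).comp (h.transition n).toRingHom :=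
    h.level_hom_ext fun b => by
      change r n (ψ (n + 1) _) = ψ n (h.transition n _)
      rw [hψ, hr, transition_toLevel, hψ]
  have hlim (z : h.completion) : ∃ y, ∀ n, q n y = ψ n (z.1 n) := by
    choose y hy using fun n => Ideal.Quotient.mk_surjective (ψ n (z.1 n))
    obtain ⟨m, hm⟩ := hρ.complete.exists_lim y fun n => by
      rw [← hq, ← hr]
      change r n (Ideal.Quotient.mk _ _) = Ideal.Quotient.mk _ _
      rw [hy, hy, ← z.2 n]
      exact RingHom.congr_fun (hcompat n) _
    exact ⟨m, fun n => ((hq n _ _).2 (hm n)).trans (hy n)⟩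
  choose φ hφ using hlim
  have hφι (b : B) : φ (h.toCompletion b) = ι b :=
    hqext _ _ fun n => (hφ _ n).trans (hψ n b)
  refine ⟨{ toFun := φ, map_one' := ?_, map_mul' := ?_, map_zero' := ?_, map_add' := ?_,
            commutes' := fun p => ?_ }, hφι⟩
  · exact hqext _ _ fun n => (hφ _ n).trans ((map_one (ψ n)).trans (map_one (q n)).symm)
  · refine fun a b => hqext _ _ fun n => ?_
    rw [map_mul, hφ, hφ, hφ]
    exact map_mul (ψ n) _ _
  · exact hqext _ _ fun n => (hφ _ n).trans ((map_zero (ψ n)).trans (map_zero (q n)).symm)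
  · refine fun a b => hqext _ _ fun n => ?_
    rw [map_add, hφ, hφ, hφ]
    exact map_add (ψ n) _ _
  · exact (congrArg φ (AlgHom.commutes h.toCompletion p).symm).trans
      ((hφι _).trans (AlgHom.commutes ι p))

end IsReduction

end Uniqueness

theorem mainTheorem4 {k : Type u} [Field k]
    {A : Type v} [CommRing A] [IsDomain A] [Algebra k A] (P : PoissonStructure k A)
    {K : Type w} [Field K] [Algebra k K] [Algebra A K] [IsScalarTower k A K] [IsFractionRing A K]
    {B : Type x} [Ring B] [Algebra (PowerSeries k) B] (π : B →+* A) (hB : IsQuantization P π) :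
    -- the Poisson structure of `K`: the unique one that extends the Poisson structure of `A`
    ∃ Q : PoissonStructure k K, Q.Extends P ∧
      (∀ Q' : PoissonStructure k K, Q'.Extends P → Q' = Q) ∧
      -- a quantization `L` of `K` that contains `B`
      ∃ (L : Type x) (_ : Ring L) (_ : Algebra (PowerSeries k) L) (ρ : L →+* K)
        (ι : B →ₐ[PowerSeries k] L),
        IsQuantizationContaining Q π ρ ι ∧
        -- any other one is isomorphic to it by a unique isomorphism over `B`
        (∀ (L' : Type y) [Ring L'] [Algebra (PowerSeries k) L'] (ρ' : L' →+* K)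
          (ι' : B →ₐ[PowerSeries k] L'), IsQuantizationContaining Q π ρ' ι' →
          ∃ e : L ≃ₐ[PowerSeries k] L',
            (∀ b, e (ι b) = ι' b) ∧ (∀ z, ρ' (e z) = ρ z) ∧
            ∀ e' : L ≃ₐ[PowerSeries k] L', (∀ b, e' (ι b) = ι' b) → e' = e) ∧
        -- an element of `L` is invertible as soon as it is nonzero modulo `ħ`
        (∀ z : L, ρ z ≠ 0 → ∃ z' : L, z * z' = 1 ∧ z' * z = 1) ∧
        -- the algebra `L[ħ⁻¹]` over `k((ħ))` is a skew field
        IsSkewField (TensorProduct (PowerSeries k) (LaurentSeries k) L) := by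
  have h := hB.isReduction
  have hρ := h.completion_isReduction K
  have hι := h.completionReduction_toCompletion K
  obtain ⟨Q, hQ⟩ := hρ.exists_poissonStructure
  have hQP : Q.Extends P := by
    intro a b
    obtain ⟨a, rfl⟩ := h.surjective a
    obtain ⟨b, rfl⟩ := h.surjective b
    obtain ⟨c, hc⟩ := (h.map_eq_zero_iff (a * b - b * a)).1 (by
      rw [map_sub, map_mul, map_mul, mul_comm, sub_self])
    rw [hB.bracket_eq a b c hc, ← hι, ← hι, ← hι]
    exact hQ _ _ _ (by rw [← map_mul, ← map_mul, ← map_sub, hc, map_smul])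
  refine ⟨Q, hQP, fun Q' hQ' => hQP.unique hQ', h.completion, inferInstance, inferInstance,
    h.completionReduction K, h.toCompletion, ⟨⟨hρ.complete.isTopologicallyFree,
      hρ.map_algebraMap, hρ.surjective, hρ.map_eq_zero_iff, hQ⟩, h.toCompletion_injective, hι⟩,
    fun L' _ _ ρ' ι' h' => ?_, fun z hz => ?_, hρ.isSkewField⟩
  · have hρ' := h'.isQuantization.isReduction
    obtain ⟨e, he⟩ := h.exists_algHom_completion hρ' h'.reduction
    have hred := h.map_eq_of_extends hρ hι hρ' h'.reduction he
    exact ⟨AlgEquiv.ofBijective e (hρ.bijective_of_extends hρ' e hred), he, hred,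
      fun e' he' => AlgEquiv.ext fun z =>
        h.algHom_ext_of_extends hρ hι hρ' h'.reduction (e := e'.toAlgHom) (e' := e) he' he z⟩
  · obtain ⟨u, rfl⟩ := hρ.isUnit hz
    exact ⟨_, u.mul_inv, u.inv_mul⟩
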